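/- Let $\tau>0$ and let $\mu$ be a finite signed Borel measure on $[-\tau,0]$. Let $Ces(\mathbb{R}_+;\mathbb{R})$ be the set of $g\in L^1_{loc}(\mathbb{R}_+;\mathbb{R})$ for which $\lim_{t\to\infty}\frac1t\int_0^t g(s)\,ds$ exists in $\mathbb{R}$. For $\psi\in C([-\tau,0];\mathbb{R})$ and $f\in L^1_{loc}(\mathbb{R}_+;\mathbb{R})$ let $x(\cdot,\psi)$ be the solution of $$x'(t)=\int_{[-\tau,0]}x(t+u)\,\mu(du)+f(t)\quad\text{for a.e. } t\ge 0,\qquad x(t)=\psi(t)\quad\text{for } t\in[-\tau,0],$$ that is, the function that equals $\psi$ on $[-\tau,0]$, is locally absolutely continuous on $[0,\infty)$, and satisfies the equation almost everywhere. Let $r_\tau$ be the resolvent: $r_\tau(t)=0$ for $t<0$, $r_\tau(0)=1$, $r_\tau$ is locally absolutely continuous on $[0,\infty)$, and $r_\tau'(t)=\int_{[-\tau,0]}r_\tau(t+u)\,\mu(du)$ for a.e. $t>0$. Suppose that, for every $\psi\in C([-\tau,0];\mathbb{R})$ and every $f\in L^1_{loc}(\mathbb{R}_+;\mathbb{R})$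 such that $t\mapsto\int_t^{t+\theta}f(s)\,ds$ belongs to $Ces(\mathbb{R}_+;\mathbb{R})$ for all $\theta\in(0,1]$, we have $x(\cdot,\psi)\in Ces(\mathbb{R}_+;\mathbb{R})$. Then $r_\tau\in L^1(\mathbb{R}_+;\mathbb{R})$; moreover, every characteristic root, i.e. every $\lambda\in\mathbb{C}$ with $\lambda=\int_{[-\tau,0]}e^{\lambda s}\,\mu(ds)$, satisfies $\operatorname{Re}\lambda<0$. -/

import Mathlib

open MeasureTheory Set Filter Topology

/-- `g` is locally integrable on `[0, ∞)` and has a (finite) Cesàro limit: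
`(1 / t) ∫₀ᵗ g(s) ds → L` as `t → ∞` for some real `L`. -/
def IsCesaro (g : ℝ → ℝ) : Prop :=
  LocallyIntegrableOn g (Ici 0) ∧
    ∃ L : ℝ, Tendsto (fun t : ℝ => (1 / t) * ∫ s in (0 : ℝ)..t, g s) atTop (𝓝 L)

/-- `g` is locally absolutely continuous on `[0, ∞)`. -/
def LocallyAC (g : ℝ → ℝ) : Prop :=
  ∀ T : ℝ, 0 < T → AbsolutelyContinuousOnInterval g 0 T

/-- `x` is a solution of the perturbed linear delay equation
`x'(t) = ∫_{[-τ,0]} x(t + u) μ(du) + f(t)` for almost every `t ≥ 0`, `x = ψ` on `[-τ, 0]`,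
where `μ` is a finite signed Borel measure on `[-τ, 0]`.
Only the values of `x` on `[-τ, ∞)` and those of `f` on `[0, ∞)` matter. -/
structure IsDelaySolution (τ : ℝ) (μ : SignedMeasure (Icc (-τ) (0 : ℝ)))
    (ψ : C(Icc (-τ) (0 : ℝ), ℝ)) (f x : ℝ → ℝ) : Prop where
  locallyAC : LocallyAC x
  initial : ∀ s : Icc (-τ) (0 : ℝ), x s = ψ s
  deriv : ∀ᵐ t ∂(volume.restrict (Ici (0 : ℝ))),
    HasDerivAt x ((∫ᵛ u, x (t + (u : ℝ)) ∂<•μ) + f t) t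

/-- `r` is the (differential) resolvent of the delay equation: `r(t) = 0` for `t < 0`, `r(0) = 1`,
`r` is locally absolutely continuous on `[0, ∞)`, and `r'(t) = ∫_{[-τ,0]} r(t + u) μ(du)` for
almost every `t > 0`. As `r` vanishes on the negative axis, the integral is the convolution
`∫_{[0,t]} r(t - s) μ̃(ds)` of `r` with the reflection `μ̃` of `μ`. -/
structure IsDelayResolvent (τ : ℝ) (μ : SignedMeasure (Icc (-τ) (0 : ℝ)))
    (r : ℝ → ℝ) : Prop where
  locallyAC : LocallyAC r
  of_neg : ∀ t : ℝ, t < 0 → r t = 0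
  at_zero : r 0 = 1
  deriv : ∀ᵐ t ∂(volume.restrict (Ioi (0 : ℝ))),
    HasDerivAt r (∫ᵛ u, r (t + (u : ℝ)) ∂<•μ) t

/-- The characteristic function `h(z) = z - ∫_{[-τ,0]} e^{z s} μ(ds)` of the delay equation; its
zeros are the characteristic roots. -/
noncomputable def delayChar (τ : ℝ) (μ : SignedMeasure (Icc (-τ) (0 : ℝ))) (z : ℂ) : ℂ :=
  z - ∫ᵛ s, Complex.exp (z * ((s : ℝ) : ℂ)) ∂<•μ

/-!
The two conclusions are obtained by feeding suitable perturbations into the hypothesis, named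
`PreservesCesaro` below.

*Integrability of the resolvent.* Write `*` for the convolution of functions vanishing on the
negative axis, and let `E(t) = e^{-t}` on `[0, ∞)`. If `g(t) = t⁺ φ(t)` with `φ ∈ C₀(ℝ)`, then
`F = E * g` satisfies `F(t) = o(t)`, so its derivative `f = g - F`, whose window integrals are
`F(t + θ) - F(t)`, is an admissible perturbation. The solution with zero initial function is
`r * f`, and its mean over `[0, t]` is `(r * F)(t) / t = (q * g)(t) / t` with `q = E * r`.
By hypothesis these means converge for every `φ` (`IsDelayResolvent.exists_tendsto`), so
the Banach–Steinhaus theorem on `C₀(ℝ)` bounds the norms of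
the functionals `φ ↦ (1/t) ∫ q(t - s) s⁺ φ(s) ds`, that is, essentially `(1/t) ∫₀ᵗ |q(t - s)| s ds`.
Since `s ≥ t/2` on `[t/2, t]`, this gives `q ∈ L¹` (`integrable_of_forall_tendsto`). Finally
`q' = r - q` and `q' = E + μ q`, where `μ q = ∫ q(· + u) μ(du)`, so that `r = q + E + μ q` is
integrable too (`IsDelayResolvent.eq_smoothed`). The smoothing by `E` is what makes `F`
differentiable for every continuous `φ`, so that uniform boundedness can be used in the sup norm.

*Characteristic roots.* If `z` is a root, `e^{zt}` solves the unperturbed equation; for `Re z > 0`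
it has no Cesàro limit (`PreservesCesaro.re_nonpos`). If `Re z = 0`, then `t e^{zt}` solves the
equation with perturbation `h'(z) e^{zt}`, where `h` is the characteristic function; this
perturbation is admissible, but the means of `t e^{zt}` behave like `e^{zt} / z`, or like `t / 2` when `z = 0`, and
do not converge (`PreservesCesaro.re_ne_zero`).
-/

open scoped ZeroAtInfty

/-! ### The algebra of causal functions -/

section Convolution

/-- A measurable function that vanishes on the negative axis and is bounded on every half-line
`(-∞, T]`. Local boundedness, rather than local integrability, makes every convolution of two such
functions converge at every point. -/
structure Causal (a : ℝ → ℝ) : Prop where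
  measurable : Measurable a
  of_neg : ∀ t : ℝ, t < 0 → a t = 0
  bounded : ∀ T : ℝ, ∃ C : ℝ, ∀ t ≤ T, |a t| ≤ C

/-- The convolution `∫ a(s) b(t - s) ds` over the whole real line. For causal functions only
`s ∈ [0, t]` contributes. -/
noncomputable def causalConv (a b : ℝ → ℝ) (t : ℝ) : ℝ := ∫ s, a s * b (t - s)

variable {a b c : ℝ → ℝ}

namespace Causal

lemma exists_bound (ha : Causal a) (T : ℝ) : ∃ C : ℝ, 0 ≤ C ∧ ∀ t ≤ T, |a t| ≤ C := by
  obtain ⟨C, hC⟩ := ha.bounded T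
  exact ⟨C, (abs_nonneg _).trans (hC T le_rfl), hC⟩

lemma mul_eq_zero_of_notMem (ha : Causal a) (hb : Causal b) {s t : ℝ} (hs : s ∉ Icc 0 t) :
    a s * b (t - s) = 0 := by
  rcases lt_or_ge s 0 with h | h
  · simp [ha.of_neg s h]
  · have : t < s := by
      by_contra! h'
      exact hs ⟨h, h'⟩
    simp [hb.of_neg (t - s) (by linarith)]

/-- The integrand of a convolution is dominated by a multiple of the indicator of `[0, T]`,
uniformly for `t ≤ T`. -/
lemma exists_norm_le_indicator (ha : Causal a) (hb : Causal b) (T : ℝ) :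
    ∃ C : ℝ, 0 ≤ C ∧ ∀ t ≤ T, ∀ s,
      ‖a s * b (t - s)‖ ≤ (Icc 0 T).indicator (fun _ => C) s := by
  obtain ⟨A, hA0, hA⟩ := ha.exists_bound T
  obtain ⟨B, hB0, hB⟩ := hb.exists_bound T
  refine ⟨A * B, by positivity, fun t ht s => ?_⟩
  by_cases hs : s ∈ Icc 0 t
  · have hs' : s ∈ Icc 0 T := ⟨hs.1, hs.2.trans ht⟩
    rw [indicator_of_mem hs', norm_mul, Real.norm_eq_abs, Real.norm_eq_abs]
    exact mul_le_mul (hA s (hs.2.trans ht)) (hB _ (by linarith [hs.1])) (abs_nonneg _) hA0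
  · rw [mul_eq_zero_of_notMem ha hb hs, norm_zero]
    exact indicator_nonneg (fun _ _ => by positivity) s

lemma integrable_indicator_Icc (T C : ℝ) : Integrable ((Icc 0 T).indicator fun _ : ℝ => C) :=
  (integrable_indicator_iff measurableSet_Icc).2 (by simp)

lemma integrable_conv (ha : Causal a) (hb : Causal b) (t : ℝ) :
    Integrable fun s => a s * b (t - s) := by
  obtain ⟨C, -, hC⟩ := exists_norm_le_indicator ha hb t
  refine (integrable_indicator_Icc t C).mono' ?_ (Eventually.of_forall (hC t le_rfl))
  exact (ha.measurable.mul (hb.measurable.comp (by fun_prop))).aestronglyMeasurable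

lemma conv (ha : Causal a) (hb : Causal b) : Causal (causalConv a b) where
  measurable := by
    have : StronglyMeasurable fun p : ℝ × ℝ => a p.2 * b (p.1 - p.2) :=
      ((ha.measurable.comp measurable_snd).mul
        (hb.measurable.comp (by fun_prop))).stronglyMeasurable
    exact this.integral_prod_right.measurable
  of_neg t ht := by
    have : ∀ s, a s * b (t - s) = 0 := fun s =>
      mul_eq_zero_of_notMem ha hb fun hs => by linarith [hs.1, hs.2]
    simp [causalConv, this]
  bounded T := by
    obtain ⟨C, -, hC⟩ := exists_norm_le_indicator ha hb T
    exact ⟨_, fun t ht => norm_integral_le_of_norm_le (integrable_indicator_Icc T C)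
      (Eventually.of_forall (hC t ht))⟩

lemma abs (ha : Causal a) : Causal fun t => |a t| where
  measurable := ha.measurable.abs
  of_neg t ht := by simp [ha.of_neg t ht]
  bounded T := by simpa using ha.bounded T

lemma add (ha : Causal a) (hb : Causal b) : Causal (a + b) where
  measurable := ha.measurable.add hb.measurable
  of_neg t ht := by simp [ha.of_neg t ht, hb.of_neg t ht]
  bounded T := by
    obtain ⟨A, hA⟩ := ha.bounded T
    obtain ⟨B, hB⟩ := hb.bounded T
    exact ⟨A + B, fun t ht => (abs_add_le _ _).trans (add_le_add (hA t ht) (hB t ht))⟩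

lemma neg (ha : Causal a) : Causal (-a) where
  measurable := ha.measurable.neg
  of_neg t ht := by simp [ha.of_neg t ht]
  bounded T := by simpa using ha.bounded T

lemma sub (ha : Causal a) (hb : Causal b) : Causal (a - b) := by
  simpa [sub_eq_add_neg] using ha.add hb.neg

/-- A function that vanishes on the negative axis and is continuous on `[0, ∞)` is causal; a jump
at the origin is allowed. -/
lemma of_continuousOn (h : ContinuousOn a (Ici 0)) (h0 : ∀ t < 0, a t = 0) : Causal a where
  measurable := by
    have : a = (Ici (0 : ℝ)).piecewise a (fun _ => 0) := by
      ext t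
      by_cases ht : t ∈ Ici (0 : ℝ)
      · simp [ht]
      · simp [ht, h0 t (not_le.1 ht)]
    rw [this]
    exact h.measurable_piecewise continuousOn_const measurableSet_Ici
  of_neg := h0
  bounded T := by
    obtain ⟨C, hC⟩ := (isCompact_Icc (a := (0 : ℝ)) (b := T)).exists_bound_of_continuousOn
      (h.mono Icc_subset_Ici_self)
    refine ⟨max C 0, fun t ht => ?_⟩
    rcases lt_or_ge t 0 with h' | h'
    · simp [h0 t h']
    · exact (hC t ⟨h', ht⟩).trans (le_max_left _ _)

end Causal

lemma causalConv_comm (a b : ℝ → ℝ) : causalConv a b = causalConv b a := by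
  ext t
  rw [causalConv, ← integral_sub_left_eq_self _ volume t]
  simp [causalConv, mul_comm]

lemma causalConv_add (ha : Causal a) (hb : Causal b) (hc : Causal c) :
    causalConv a (b + c) = causalConv a b + causalConv a c := by
  ext t
  simp only [causalConv, Pi.add_apply, mul_add]
  exact integral_add (ha.integrable_conv hb t) (ha.integrable_conv hc t)

lemma causalConv_sub (ha : Causal a) (hb : Causal b) (hc : Causal c) :
    causalConv a (b - c) = causalConv a b - causalConv a c := by
  ext t
  simp only [causalConv, Pi.sub_apply, mul_sub]
  exact integral_sub (ha.integrable_conv hb t) (ha.integrable_conv hc t)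

lemma causalConv_assoc (ha : Causal a) (hb : Causal b) (hc : Causal c) :
    causalConv (causalConv a b) c = causalConv a (causalConv b c) := by
  ext t
  refine convolution_assoc (ContinuousLinearMap.mul ℝ ℝ) (ContinuousLinearMap.mul ℝ ℝ)
    (ContinuousLinearMap.mul ℝ ℝ) (ContinuousLinearMap.mul ℝ ℝ) (ν := volume) (μ := volume)
    (f := a) (g := b) (k := c) (fun x y z => by simp [mul_assoc])
    ha.measurable.aestronglyMeasurable hb.measurable.aestronglyMeasurable
    hc.measurable.aestronglyMeasurable (Eventually.of_forall fun y => ha.integrable_conv hb y)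
    (Eventually.of_forall fun y => hb.abs.integrable_conv hc.abs y)
    (ha.abs.integrable_conv (hb.abs.conv hc.abs) t)

lemma causalConv_eq_intervalIntegral (ha : Causal a) (hb : Causal b) {t : ℝ} (ht : 0 ≤ t) :
    causalConv a b t = ∫ s in (0 : ℝ)..t, a s * b (t - s) := by
  rw [intervalIntegral.integral_of_le ht, ← integral_Icc_eq_integral_Ioc, causalConv,
    setIntegral_eq_integral_of_forall_compl_eq_zero]
  exact fun s hs => Causal.mul_eq_zero_of_notMem ha hb hs

lemma Causal.intervalIntegrable (ha : Causal a) (s t : ℝ) :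
    IntervalIntegrable a volume s t := by
  obtain ⟨C, hC⟩ := ha.bounded (max s t)
  refine IntervalIntegrable.mono_fun' (g := fun _ => C) intervalIntegrable_const
    ha.measurable.aestronglyMeasurable ?_
  filter_upwards [ae_restrict_mem measurableSet_uIoc] with x hx
  exact hC x hx.2

/-- The Heaviside function, with value `1` at the origin. -/
noncomputable def heaviside : ℝ → ℝ := (Ici (0 : ℝ)).indicator fun _ => 1

lemma heaviside_of_nonneg {t : ℝ} (ht : 0 ≤ t) : heaviside t = 1 := by
  simp [heaviside, ht]

lemma causal_heaviside : Causal heaviside :=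
  .of_continuousOn (continuousOn_const.congr fun _ ht => heaviside_of_nonneg ht)
    fun t ht => by simp [heaviside, ht]

/-- Convolution with the Heaviside function is integration from the origin. -/
lemma causalConv_heaviside (ha : Causal a) (t : ℝ) :
    causalConv heaviside a t = ∫ s in (0 : ℝ)..t, a s := by
  rcases lt_or_ge t 0 with ht | ht
  · rw [(causal_heaviside.conv ha).of_neg t ht, intervalIntegral.integral_symm,
      intervalIntegral.integral_of_le ht.le, ← integral_Ico_eq_integral_Ioc,
      setIntegral_eq_zero_of_forall_eq_zero fun s hs => ha.of_neg s hs.2, neg_zero]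
  · rw [causalConv_comm, causalConv_eq_intervalIntegral ha causal_heaviside ht]
    refine intervalIntegral.integral_congr fun s hs => ?_
    rw [uIcc_of_le ht] at hs
    simp [heaviside_of_nonneg (sub_nonneg.2 hs.2)]

lemma continuous_causalConv_heaviside (ha : Causal a) : Continuous (causalConv heaviside a) := by
  rw [show causalConv heaviside a = fun t => ∫ s in (0 : ℝ)..t, a s from
    funext (causalConv_heaviside ha)]
  exact intervalIntegral.continuous_primitive (fun s t => ha.intervalIntegrable s t) 0

/-! ### The delay operator -/

section Delay

variable {τ : ℝ} {μ : SignedMeasure (Icc (-τ) (0 : ℝ))}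

/-- The operator `a ↦ ∫ a(· + u) μ(du)` on the right-hand side of the delay equation. -/
noncomputable def delayOp (μ : SignedMeasure (Icc (-τ) (0 : ℝ))) (a : ℝ → ℝ) (t : ℝ) : ℝ :=
  ∫ᵛ u, a (t + (u : ℝ)) ∂<•μ

/-- The integral against a signed measure through its Jordan decomposition. -/
lemma SignedMeasure.integral_eq_sub {X E : Type*} [MeasurableSpace X] [NormedAddCommGroup E]
    [NormedSpace ℝ E]
    (μ : SignedMeasure X) {f : X → E}
    (hp : Integrable f μ.toJordanDecomposition.posPart)
    (hn : Integrable f μ.toJordanDecomposition.negPart) :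
    ∫ᵛ x, f x ∂<•μ = ∫ x, f x ∂μ.toJordanDecomposition.posPart
      - ∫ x, f x ∂μ.toJordanDecomposition.negPart := by
  conv_lhs => rw [← μ.toSignedMeasure_toJordanDecomposition]
  rw [JordanDecomposition.toSignedMeasure, VectorMeasure.integral_sub_vectorMeasure,
    VectorMeasure.integral_toSignedMeasure, VectorMeasure.integral_toSignedMeasure]
  · simpa [VectorMeasure.Integrable] using hp
  · simpa [VectorMeasure.Integrable] using hn

lemma Causal.integrable_shift (ha : Causal a) (ν : Measure (Icc (-τ) (0 : ℝ)))
    [IsFiniteMeasure ν] (t : ℝ) : Integrable (fun u : Icc (-τ) (0 : ℝ) => a (t + (u : ℝ))) ν := by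
  obtain ⟨C, hC⟩ := ha.bounded t
  exact .of_bound (ha.measurable.comp (by fun_prop)).aestronglyMeasurable C
    (Eventually.of_forall fun u => hC _ (by linarith [u.2.2]))

lemma delayOp_eq (ha : Causal a) (t : ℝ) :
    delayOp μ a t = ∫ u, a (t + (u : ℝ)) ∂μ.toJordanDecomposition.posPart
      - ∫ u, a (t + (u : ℝ)) ∂μ.toJordanDecomposition.negPart :=
  SignedMeasure.integral_eq_sub μ (ha.integrable_shift _ t) (ha.integrable_shift _ t)

lemma Causal.integral_shift (ha : Causal a) (ν : Measure (Icc (-τ) (0 : ℝ)))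
    [IsFiniteMeasure ν] : Causal fun t => ∫ u, a (t + (u : ℝ)) ∂ν where
  measurable := by
    have : StronglyMeasurable fun p : ℝ × Icc (-τ) (0 : ℝ) => a (p.1 + (p.2 : ℝ)) :=
      (ha.measurable.comp (by fun_prop)).stronglyMeasurable
    exact this.integral_prod_right.measurable
  of_neg t ht := by
    have : ∀ u : Icc (-τ) (0 : ℝ), a (t + (u : ℝ)) = 0 := fun u =>
      ha.of_neg _ (by linarith [u.2.2])
    simp [this]
  bounded T := by
    obtain ⟨C, hC⟩ := ha.bounded T
    refine ⟨C * ν.real univ, fun t ht => ?_⟩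
    rw [← Real.norm_eq_abs]
    exact norm_integral_le_of_norm_le_const
      (Eventually.of_forall fun u => hC _ (by linarith [u.2.2]))

lemma Causal.delayOp (ha : Causal a) : Causal (delayOp μ a) := by
  rw [show _root_.delayOp μ a = _ from funext (delayOp_eq ha)]
  exact (ha.integral_shift _).sub (ha.integral_shift _)

lemma integral_shift_causalConv (ha : Causal a) (hb : Causal b)
    (ν : Measure (Icc (-τ) (0 : ℝ))) [IsFiniteMeasure ν] (t : ℝ) :
    ∫ u, causalConv a b (t + (u : ℝ)) ∂ν
      = causalConv a (fun t => ∫ u, b (t + (u : ℝ)) ∂ν) t := by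
  simp only [causalConv, ← integral_const_mul]
  obtain ⟨C, hC0, hC⟩ := Causal.exists_norm_le_indicator ha hb t
  rw [integral_integral_swap]
  · simp only [add_sub_right_comm]
  · refine ((Causal.integrable_indicator_Icc t C).comp_snd ν).mono' ?_
      (Eventually.of_forall fun p => hC _ (by linarith [p.1.2.2]) _)
    exact ((ha.measurable.comp measurable_snd).mul
      (hb.measurable.comp (by fun_prop))).aestronglyMeasurable

/-- The delay operator is itself a convolution, hence commutes with convolutions. -/
lemma delayOp_causalConv (ha : Causal a) (hb : Causal b) :
    delayOp μ (causalConv a b) = causalConv a (delayOp μ b) := by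
  ext t
  rw [delayOp_eq (ha.conv hb), integral_shift_causalConv ha hb, integral_shift_causalConv ha hb,
    ← Pi.sub_apply, ← causalConv_sub ha (hb.integral_shift _) (hb.integral_shift _)]
  congr 1
  ext s
  exact (delayOp_eq hb s).symm

lemma continuous_delayOp (ha : Causal a) (h : Continuous a) : Continuous (delayOp μ a) := by
  have key : ∀ (ν : Measure (Icc (-τ) (0 : ℝ))) [IsFiniteMeasure ν],
      Continuous fun t => ∫ u, a (t + (u : ℝ)) ∂ν := fun ν _ => by
    refine continuous_iff_continuousAt.2 fun t₀ => ?_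
    obtain ⟨C, hC⟩ := ha.bounded (t₀ + 1)
    refine continuousAt_of_dominated (bound := fun _ => C)
      (Eventually.of_forall fun t => by fun_prop) ?_ (integrable_const C)
      (Eventually.of_forall fun u => by fun_prop)
    filter_upwards [eventually_lt_nhds (lt_add_one t₀)] with t ht
    exact Eventually.of_forall fun u => hC _ (by linarith [u.2.2])
  rw [show delayOp μ a = _ from funext (delayOp_eq ha)]
  exact (key _).sub (key _)

lemma integrable_delayOp (ha : Causal a) (h : Integrable a) : Integrable (delayOp μ a) := by
  have key : ∀ (ν : Measure (Icc (-τ) (0 : ℝ))) [IsFiniteMeasure ν],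
      Integrable fun t => ∫ u, a (t + (u : ℝ)) ∂ν := fun ν _ => by
    have : Integrable (fun p : ℝ × Icc (-τ) (0 : ℝ) => a (p.1 + (p.2 : ℝ)))
        (volume.prod ν) := by
      have hm : Measurable fun p : ℝ × Icc (-τ) (0 : ℝ) => a (p.1 + (p.2 : ℝ)) :=
        ha.measurable.comp (by fun_prop)
      rw [integrable_prod_iff' hm.aestronglyMeasurable]
      refine ⟨Eventually.of_forall fun u => h.comp_add_right (u : ℝ), ?_⟩
      simp only [integral_add_right_eq_self (fun t => ‖a t‖)]
      exact integrable_const _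
    exact this.integral_prod_left
  rw [show delayOp μ a = _ from funext (delayOp_eq ha)]
  exact (key _).sub (key _)

end Delay

end Convolution

/-! ### The smoothed resolvent -/

/-- The kernel `e^{-t}` on `[0, ∞)`, extended by zero. -/
noncomputable def expKernel : ℝ → ℝ := (Ici (0 : ℝ)).indicator fun t => Real.exp (-t)

lemma expKernel_of_nonneg {t : ℝ} (ht : 0 ≤ t) : expKernel t = Real.exp (-t) := by
  simp [expKernel, ht]

lemma expKernel_of_neg {t : ℝ} (ht : t < 0) : expKernel t = 0 := by
  simp [expKernel, ht]

lemma expKernel_nonneg (t : ℝ) : 0 ≤ expKernel t :=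
  indicator_nonneg (fun _ _ => (Real.exp_pos _).le) t

lemma causal_expKernel : Causal expKernel :=
  .of_continuousOn
    ((Continuous.continuousOn (by fun_prop)).congr fun _ ht => expKernel_of_nonneg ht)
    fun _ ht => expKernel_of_neg ht

lemma integrable_expKernel : Integrable expKernel := by
  rw [expKernel, integrable_indicator_iff measurableSet_Ici, integrableOn_Ici_iff_integrableOn_Ioi]
  simpa using integrableOn_exp_neg_Ioi 0

/-- The differential equation `E' = δ₀ - E` of the exponential kernel, in integrated form. -/
lemma causalConv_heaviside_expKernel :
    causalConv heaviside expKernel = heaviside - expKernel := by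
  ext t
  rcases lt_or_ge t 0 with ht | ht
  · simp [(causal_heaviside.conv causal_expKernel).of_neg t ht, causal_heaviside.of_neg t ht,
      expKernel_of_neg ht]
  · rw [causalConv_heaviside causal_expKernel, Pi.sub_apply, heaviside_of_nonneg ht,
      expKernel_of_nonneg ht]
    have : ∀ s ∈ uIcc 0 t, expKernel s = Real.exp (-s) := fun s hs => by
      rw [uIcc_of_le ht] at hs
      exact expKernel_of_nonneg hs.1
    rw [intervalIntegral.integral_congr this,
      intervalIntegral.integral_comp_neg (fun s => Real.exp s), integral_exp]
    simp

section Resolvent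

variable {τ : ℝ} {μ : SignedMeasure (Icc (-τ) (0 : ℝ))} {r : ℝ → ℝ}

lemma IsDelayResolvent.causal (hr : IsDelayResolvent τ μ r) : Causal r := by
  refine .of_continuousOn (fun t ht => ?_) hr.of_neg
  have hT : (0 : ℝ) < t + 1 := by linarith [mem_Ici.1 ht]
  have := (hr.locallyAC (t + 1) hT).continuousOn
  rw [uIcc_of_le hT.le] at this
  refine (this t ⟨ht, by linarith⟩).mono_of_mem_nhdsWithin ?_
  rw [← Ici_inter_Iic]
  exact inter_mem self_mem_nhdsWithin (mem_nhdsWithin_of_mem_nhds (Iic_mem_nhds (by linarith)))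

/-- The resolvent equation in integrated form: `r = 1 + ∫₀ᵗ (μ r)`. -/
lemma IsDelayResolvent.eq_heaviside_add (hr : IsDelayResolvent τ μ r) :
    r = heaviside + causalConv heaviside (delayOp μ r) := by
  have hm : Causal (delayOp μ r) := hr.causal.delayOp
  ext t
  rw [Pi.add_apply]
  rcases lt_or_ge t 0 with ht | ht
  · rw [hr.of_neg t ht, causal_heaviside.of_neg t ht, (causal_heaviside.conv hm).of_neg t ht,
      add_zero]
  rw [causalConv_heaviside hm, heaviside_of_nonneg ht]
  rcases ht.eq_or_lt with rfl | ht
  · simp [hr.at_zero]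
  have hd : ∫ s in (0 : ℝ)..t, delayOp μ r s = ∫ s in (0 : ℝ)..t, _root_.deriv r s := by
    refine intervalIntegral.integral_congr_ae ?_
    filter_upwards [(ae_restrict_iff' measurableSet_Ioi).1 hr.deriv] with s hs hst
    rw [uIoc_of_le ht.le] at hst
    exact (hs hst.1).deriv.symm
  rw [hd, (hr.locallyAC t ht).integral_deriv_eq_sub, hr.at_zero]
  ring

/-- The resolvent can be recovered from its smoothing `q = E * r`. -/
lemma IsDelayResolvent.eq_smoothed (hr : IsDelayResolvent τ μ r) :
    r = causalConv expKernel r + expKernel + delayOp μ (causalConv expKernel r) := by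
  have hm : Causal (delayOp μ r) := hr.causal.delayOp
  have hH := causal_heaviside
  have hE := causal_expKernel
  have key : causalConv expKernel r = r - expKernel - causalConv expKernel (delayOp μ r) := by
    conv_lhs => rw [hr.eq_heaviside_add]
    rw [causalConv_add hE hH (hH.conv hm), ← causalConv_assoc hE hH hm,
      causalConv_comm expKernel heaviside, causalConv_heaviside_expKernel,
      causalConv_comm _ (delayOp μ r), causalConv_sub hm hH hE,
      causalConv_comm (delayOp μ r) heaviside, causalConv_comm (delayOp μ r) expKernel]
    linear_combination -hr.eq_heaviside_add
  rw [delayOp_causalConv hE hr.causal]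
  conv_rhs => rw [key]
  abel

lemma IsDelayResolvent.continuous_smoothed (hr : IsDelayResolvent τ μ r) :
    Continuous (causalConv expKernel r) := by
  have hm : Causal (delayOp μ r) := hr.causal.delayOp
  have hH := causal_heaviside
  have hE := causal_expKernel
  have : causalConv expKernel r
      = causalConv heaviside (expKernel + causalConv expKernel (delayOp μ r)) := by
    conv_lhs => rw [hr.eq_heaviside_add]
    rw [causalConv_add hE hH (hH.conv hm), causalConv_add hH hE (hE.conv hm),
      ← causalConv_assoc hE hH hm, ← causalConv_assoc hH hE hm, causalConv_comm expKernel heaviside]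
  rw [this]
  exact continuous_causalConv_heaviside (hE.add (hE.conv hm))

lemma IsDelayResolvent.integrable_of_smoothed (hr : IsDelayResolvent τ μ r)
    (h : Integrable (causalConv expKernel r)) : Integrable r := by
  rw [hr.eq_smoothed]
  exact (h.add integrable_expKernel).add
    (integrable_delayOp (causal_expKernel.conv hr.causal) h)

/-- Variation of constants for the inhomogeneous equation with zero initial function, in
integrated form. -/
lemma IsDelayResolvent.causalConv_eq (hr : IsDelayResolvent τ μ r) {f : ℝ → ℝ} (hf : Causal f) :
    causalConv r f = causalConv heaviside (f + delayOp μ (causalConv r f)) := by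
  have hm : Causal (delayOp μ r) := hr.causal.delayOp
  have hH := causal_heaviside
  rw [causalConv_comm r f, delayOp_causalConv hf hr.causal, causalConv_add hH hf (hf.conv hm),
    ← causalConv_assoc hH hf hm, causalConv_comm heaviside f, causalConv_assoc hf hH hm,
    ← causalConv_add hf hH (hH.conv hm), ← hr.eq_heaviside_add]

lemma IsDelayResolvent.isDelaySolution_causalConv (hr : IsDelayResolvent τ μ r) {f : ℝ → ℝ}
    (hf : Causal f) (hfc : Continuous f) : IsDelaySolution τ μ 0 f (causalConv r f) := by
  have hx : Causal (causalConv r f) := hr.causal.conv hf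
  have hd : Causal (f + delayOp μ (causalConv r f)) := hf.add hx.delayOp
  have hxi : causalConv r f = fun t => ∫ s in (0 : ℝ)..t, (f + delayOp μ (causalConv r f)) s :=
    (hr.causalConv_eq hf).trans (funext (causalConv_heaviside hd))
  have hxc : Continuous (causalConv r f) := by
    rw [hr.causalConv_eq hf]
    exact continuous_causalConv_heaviside hd
  refine ⟨fun T hT => ?_, fun s => ?_, Eventually.of_forall fun t => ?_⟩
  · rw [hxi]
    exact (hd.intervalIntegrable 0 T).absolutelyContinuousOnInterval_intervalIntegral (by simp)
  · rcases s.2.2.eq_or_lt with h | h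
    · rw [h, hxi]
      simp
    · rw [hx.of_neg _ h]
      simp
  · have hc : Continuous (f + delayOp μ (causalConv r f)) := hfc.add (continuous_delayOp hx hxc)
    have := hc.integral_hasStrictDerivAt 0 t
    rw [← hxi] at this
    refine this.hasDerivAt.congr_deriv ?_
    simp [delayOp, add_comm]

end Resolvent

/-! ### Sublinear primitives give admissible perturbations -/

/-- The hypothesis of the theorem: every perturbation all of whose window integrals
`∫ₜ^{t+θ} f`, `θ ∈ (0, 1]`, have a Cesàro limit produces only solutions with a Cesàro limit. -/
def PreservesCesaro (τ : ℝ) (μ : SignedMeasure (Icc (-τ) (0 : ℝ))) : Prop :=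
  ∀ (ψ : C(Icc (-τ) (0 : ℝ), ℝ)) (f : ℝ → ℝ),
    LocallyIntegrableOn f (Ici 0) →
    (∀ θ ∈ Ioc (0 : ℝ) 1, IsCesaro (fun t => ∫ s in t..(t + θ), f s)) →
    ∀ x : ℝ → ℝ, IsDelaySolution τ μ ψ f x → IsCesaro x

/-- By telescoping, the integral over `[0, T]` of `F(· + θ) - F` only sees `F` on `[T, T + θ]` and
`[0, θ]`. -/
lemma isCesaro_shift_sub {F : ℝ → ℝ} (hF : Continuous F) (hF0 : F =o[atTop] (id : ℝ → ℝ))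
    {θ : ℝ} (hθ : θ ∈ Ioc (0 : ℝ) 1) : IsCesaro fun t => F (t + θ) - F t := by
  have hi : ∀ s t : ℝ, IntervalIntegrable F volume s t := fun s t => hF.intervalIntegrable s t
  refine ⟨(by fun_prop : Continuous fun t => F (t + θ) - F t).locallyIntegrable.locallyIntegrableOn
    _, 0, ?_⟩
  have hint : ∀ T : ℝ, ∫ s in (0 : ℝ)..T, (F (s + θ) - F s)
      = (∫ s in T..(T + θ), F s) - ∫ s in (0 : ℝ)..θ, F s := fun T => by
    rw [intervalIntegral.integral_sub
      (Continuous.intervalIntegrable (by fun_prop) _ _) (hi _ _),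
      intervalIntegral.integral_comp_add_right, zero_add,
      ← intervalIntegral.integral_add_adjacent_intervals (hi θ T) (hi T (T + θ)),
      ← intervalIntegral.integral_add_adjacent_intervals (hi 0 θ) (hi θ T)]
    ring
  have h1 : (fun T : ℝ => ∫ s in T..(T + θ), F s) =o[atTop] (id : ℝ → ℝ) := by
    refine Asymptotics.isLittleO_iff.2 fun ε hε => ?_
    obtain ⟨S, hS⟩ := eventually_atTop.1 (Asymptotics.isLittleO_iff.1 hF0 (half_pos hε))
    filter_upwards [eventually_ge_atTop S, eventually_ge_atTop 1] with T hTS hT1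
    have := intervalIntegral.norm_integral_le_of_norm_le_const (f := F) (a := T) (b := T + θ)
      (C := ε * T) fun s hs => ?_
    · refine this.trans ?_
      rw [id, Real.norm_eq_abs, add_sub_cancel_left, abs_of_pos hθ.1, abs_of_pos (by linarith)]
      exact mul_le_of_le_one_right (by positivity) hθ.2
    · rw [uIoc_of_le (by linarith [hθ.1])] at hs
      refine (hS s (by linarith [hs.1])).trans ?_
      rw [id, Real.norm_eq_abs, abs_of_pos (by linarith [hs.1])]
      nlinarith [hs.2, hθ.2]
  have h2 : (fun _ : ℝ => ∫ s in (0 : ℝ)..θ, F s) =o[atTop] (id : ℝ → ℝ) :=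
    Asymptotics.isLittleO_const_id_atTop _
  refine (h1.sub h2).tendsto_div_nhds_zero.congr fun T => ?_
  rw [hint]
  simp only [id]
  ring

/-- The function `t⁺ φ(t) = o(t)` attached to a function `φ` vanishing at infinity. -/
noncomputable def rampMul (φ : C₀(ℝ, ℝ)) (t : ℝ) : ℝ := max t 0 * φ t

lemma continuous_rampMul (φ : C₀(ℝ, ℝ)) : Continuous (rampMul φ) :=
  (continuous_id.max continuous_const).mul φ.continuous

lemma causal_rampMul (φ : C₀(ℝ, ℝ)) : Causal (rampMul φ) :=
  .of_continuousOn (continuous_rampMul φ).continuousOn fun t ht => by simp [rampMul, ht.le]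

lemma abs_apply_le_norm (φ : C₀(ℝ, ℝ)) (t : ℝ) : |φ t| ≤ ‖φ‖ :=
  φ.toBCF.norm_coe_le_norm t

/-- Dominated convergence: the integrand of `(E * g)(t) / t` is at most `E(s) |φ(t - s)|`. -/
lemma causalConv_expKernel_rampMul_isLittleO (φ : C₀(ℝ, ℝ)) :
    causalConv expKernel (rampMul φ) =o[atTop] (id : ℝ → ℝ) := by
  have hφ : Tendsto φ atTop (𝓝 0) := φ.zero_at_infty'.mono_left atTop_le_cocompact
  have hle : ∀ t > 0, ∀ s, |expKernel s * rampMul φ (t - s) / t|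
      ≤ expKernel s * |φ (t - s)| := fun t ht s => by
    rcases lt_or_ge s 0 with hs | hs
    · simp [expKernel_of_neg hs]
    · rw [rampMul, abs_div, abs_mul, abs_mul, abs_of_nonneg (expKernel_nonneg s), abs_of_pos ht,
        div_le_iff₀ ht, mul_assoc, mul_comm _ t]
      refine mul_le_mul_of_nonneg_left ?_ (expKernel_nonneg s)
      refine mul_le_mul_of_nonneg_right ?_ (abs_nonneg _)
      rw [abs_of_nonneg (le_max_right _ _)]
      exact max_le (by linarith) ht.le
  have hlim : Tendsto (fun t => ∫ s, expKernel s * rampMul φ (t - s) / t) atTop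
      (𝓝 (∫ _ : ℝ, (0 : ℝ))) := by
    refine tendsto_integral_filter_of_dominated_convergence (fun s => expKernel s * ‖φ‖)
      (Eventually.of_forall fun t => ((causal_expKernel.measurable.mul
        ((causal_rampMul φ).measurable.comp (by fun_prop))).div_const t).aestronglyMeasurable)
      ?_ (integrable_expKernel.mul_const _) (Eventually.of_forall fun s => ?_)
    · filter_upwards [eventually_gt_atTop 0] with t ht
      exact Eventually.of_forall fun s => (hle t ht s).trans
        (mul_le_mul_of_nonneg_left (abs_apply_le_norm φ _) (expKernel_nonneg s))
    · have h0 : Tendsto (fun t => expKernel s * |φ (t - s)|) atTop (𝓝 0) := by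
        have hs := hφ.comp (tendsto_atTop_add_const_right atTop (-s) tendsto_id)
        simpa [sub_eq_add_neg] using hs.abs.const_mul (expKernel s)
      refine squeeze_zero_norm' ?_ h0
      filter_upwards [eventually_gt_atTop 0] with t ht
      exact hle t ht s
  rw [Asymptotics.isLittleO_iff_tendsto' (by
    filter_upwards [eventually_gt_atTop 0] with t ht h using absurd h ht.ne')]
  simpa [causalConv, integral_div] using hlim

/-! ### The `L¹` bound by uniform boundedness -/

section UniformBound

variable {τ : ℝ} {μ : SignedMeasure (Icc (-τ) (0 : ℝ))} {r : ℝ → ℝ}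

/-- The perturbation is `f = F'` with `F = E * g` and `g = t⁺ φ`. The primitive `F` is sublinear, so
`f` is admissible, and the mean of the corresponding solution `r * f` on `[0, t]` is
`(r * F)(t) / t = (q * g)(t) / t`, where `q = E * r`. -/
lemma IsDelayResolvent.exists_tendsto (hr : IsDelayResolvent τ μ r)
    (h : PreservesCesaro τ μ) (φ : C₀(ℝ, ℝ)) :
    ∃ L : ℝ, Tendsto (fun t : ℝ => (1 / t) * causalConv (causalConv expKernel r) (rampMul φ) t)
      atTop (𝓝 L) := by
  have hE := causal_expKernel
  have hH := causal_heaviside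
  have hg := causal_rampMul φ
  set F := causalConv expKernel (rampMul φ) with hFdef
  have hF : Causal F := hE.conv hg
  set f := rampMul φ - F with hfdef
  have hf : Causal f := hg.sub hF
  have hHf : causalConv heaviside f = F := by
    rw [hfdef, hFdef, causalConv_sub hH hg (hE.conv hg), ← causalConv_assoc hH hE hg,
      causalConv_heaviside_expKernel, causalConv_comm (_ - _), causalConv_sub hg hH hE,
      causalConv_comm heaviside, causalConv_comm expKernel]
    abel
  have hFc : Continuous F := hHf ▸ continuous_causalConv_heaviside hf
  have hfc : Continuous f := (continuous_rampMul φ).sub hFc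
  have hadm : ∀ θ ∈ Ioc (0 : ℝ) 1, IsCesaro (fun t => ∫ s in t..(t + θ), f s) := fun θ hθ => by
    have : (fun t => ∫ s in t..(t + θ), f s) = fun t => F (t + θ) - F t := by
      ext t
      rw [← hHf, causalConv_heaviside hf, causalConv_heaviside hf,
        intervalIntegral.integral_interval_sub_left (hf.intervalIntegrable _ _)
          (hf.intervalIntegrable _ _)]
    rw [this]
    exact isCesaro_shift_sub hFc (causalConv_expKernel_rampMul_isLittleO φ) hθ
  obtain ⟨-, L, hL⟩ := h 0 f (hfc.locallyIntegrable.locallyIntegrableOn _) hadm _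
    (hr.isDelaySolution_causalConv hf hfc)
  refine ⟨L, hL.congr fun t => ?_⟩
  rw [← causalConv_heaviside (hr.causal.conv hf), ← causalConv_assoc hH hr.causal hf,
    causalConv_comm heaviside r, causalConv_assoc hr.causal hH hf, hHf, hFdef,
    ← causalConv_assoc hr.causal hE hg, causalConv_comm r]

/-- The functional `φ ↦ (1/t) ∫ q(s) (t - s)⁺ φ(t - s) ds` on `C₀(ℝ, ℝ)`. -/
noncomputable def rampFunctional {q : ℝ → ℝ} (hq : Causal q) (t : ℝ) : C₀(ℝ, ℝ) →L[ℝ] ℝ :=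
  LinearMap.mkContinuous
    { toFun := fun φ => (1 / t) * causalConv q (rampMul φ) t
      map_add' := fun φ ψ => by
        have : rampMul (φ + ψ) = rampMul φ + rampMul ψ := by
          ext s
          simp [rampMul, mul_add]
        rw [this, causalConv_add hq (causal_rampMul φ) (causal_rampMul ψ), Pi.add_apply, mul_add]
      map_smul' := fun k φ => by
        have : ∀ s, q s * rampMul (k • φ) (t - s) = k * (q s * rampMul φ (t - s)) := fun s => by
          simp only [rampMul, ZeroAtInftyContinuousMap.coe_smul, Pi.smul_apply, smul_eq_mul]
          ring
        simp only [causalConv, this, integral_const_mul, RingHom.id_apply, smul_eq_mul]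
        ring }
    (|1 / t| * ∫ s, |q s * max (t - s) 0|) fun φ => by
      have hramp : Causal fun s : ℝ => max s 0 :=
        .of_continuousOn (by fun_prop) fun s hs => max_eq_right hs.le
      change ‖(1 / t) * causalConv q (rampMul φ) t‖ ≤ _
      rw [norm_mul, mul_assoc, ← integral_mul_const, Real.norm_eq_abs]
      refine mul_le_mul_of_nonneg_left ?_ (abs_nonneg _)
      refine norm_integral_le_of_norm_le ((hq.integrable_conv hramp t).abs.mul_const _)
        (Eventually.of_forall fun s => ?_)
      rw [rampMul, ← mul_assoc, norm_mul, Real.norm_eq_abs, Real.norm_eq_abs]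
      exact mul_le_mul_of_nonneg_left (abs_apply_le_norm φ _) (abs_nonneg _)

lemma rampFunctional_apply {q : ℝ → ℝ} (hq : Causal q) (t : ℝ) (φ : C₀(ℝ, ℝ)) :
    rampFunctional hq t φ = (1 / t) * causalConv q (rampMul φ) t := rfl

/-- Testing the functional on the regularized sign `k / (|k| + 1)` of `k(s) = s⁺ q(t - s)` bounds
the weighted `L¹` norm of `q` by the norm of the functional. -/
lemma integral_abs_le_norm_rampFunctional {q : ℝ → ℝ} (hq : Causal q) (hqc : Continuous q)
    {t : ℝ} (ht : 0 < t) :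
    ∫ s, |max s 0 * q (t - s)| ≤ t * (‖rampFunctional hq t‖ + 1) := by
  have hramp : Causal fun s : ℝ => max s 0 :=
    .of_continuousOn (by fun_prop) fun s hs => max_eq_right hs.le
  set k : ℝ → ℝ := fun s => max s 0 * q (t - s) with hk
  have hkc : Continuous k := by fun_prop
  have hk0 : ∀ s ∉ Icc 0 t, k s = 0 := fun s hs => hramp.mul_eq_zero_of_notMem hq hs
  have hpos : ∀ s, 0 < |k s| + 1 := fun s => by positivity
  -- Continuity of `q` and the bound `k² / (|k| + 1) ≥ |k| - 1` let `k / (|k| + 1)` replace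
  -- `sign k`.
  let φ : C₀(ℝ, ℝ) :=
    { toFun := fun s => k s / (|k s| + 1)
      continuous_toFun := hkc.div (by fun_prop) fun s => (hpos s).ne'
      zero_at_infty' := by
        refine tendsto_const_nhds.congr' ?_
        filter_upwards [(isCompact_Icc (a := (0 : ℝ)) (b := t)).compl_mem_cocompact] with s hs
        simp [hk0 s hs] }
  have hφ : ∀ s, φ s = k s / (|k s| + 1) := fun s => rfl
  have hφn : ‖φ‖ ≤ 1 := by
    refine (BoundedContinuousFunction.norm_le zero_le_one).2 fun s => ?_
    change ‖k s / (|k s| + 1)‖ ≤ 1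
    rw [norm_div, Real.norm_eq_abs, Real.norm_eq_abs, abs_of_pos (hpos s), div_le_one (hpos s)]
    linarith
  have hval : causalConv q (rampMul φ) t = ∫ s, k s * φ s := by
    rw [causalConv_comm]
    refine integral_congr_ae (Eventually.of_forall fun s => ?_)
    simp only [rampMul, hk]
    ring
  have hkφ : Integrable fun s => k s * φ s := by
    refine ((causal_rampMul φ).integrable_conv hq t).congr (Eventually.of_forall fun s => ?_)
    simp only [rampMul, hk]
    ring
  have hind := Causal.integrable_indicator_Icc t 1
  have hle : ∫ s, |k s| ≤ ∫ s, (k s * φ s + (Icc 0 t).indicator (fun _ => (1 : ℝ)) s) := by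
    refine integral_mono (hramp.integrable_conv hq t).abs (hkφ.add hind) fun s => ?_
    by_cases hs : s ∈ Icc 0 t
    · simp only [indicator_of_mem hs, hφ]
      rw [← sub_le_iff_le_add, mul_div_assoc', le_div_iff₀ (hpos s)]
      nlinarith [abs_mul_abs_self (k s)]
    · simp [hk0 s hs, hs]
  rw [integral_add hkφ hind, ← hval, integral_indicator_const _ measurableSet_Icc] at hle
  have hop : causalConv q (rampMul φ) t ≤ t * ‖rampFunctional hq t‖ := by
    have h1 : rampFunctional hq t φ ≤ ‖rampFunctional hq t‖ :=
      (le_abs_self _).trans (((rampFunctional hq t).le_opNorm φ).trans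
        (mul_le_of_le_one_right (norm_nonneg _) hφn))
    rw [rampFunctional_apply, one_div, inv_mul_le_iff₀ ht] at h1
    exact h1
  have hvol : volume.real (Icc 0 t) = t := by simp [ht.le]
  rw [hvol, smul_eq_mul, mul_one] at hle
  linarith

/-- Uniform boundedness turns the pointwise convergence of the Cesàro means, for every `φ` vanishing
at infinity, into an `L¹` bound. -/
lemma integrable_of_forall_tendsto {q : ℝ → ℝ} (hq : Causal q) (hqc : Continuous q)
    (h : ∀ φ : C₀(ℝ, ℝ), ∃ L : ℝ,
      Tendsto (fun t : ℝ => (1 / t) * causalConv q (rampMul φ) t) atTop (𝓝 L)) :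
    Integrable q := by
  obtain ⟨C, hC⟩ := banach_steinhaus (g := fun n : ℕ => rampFunctional hq (n : ℝ)) fun φ => by
    obtain ⟨L, hL⟩ := h φ
    obtain ⟨B, hB⟩ := (hL.comp tendsto_natCast_atTop_atTop).norm.bddAbove_range
    exact ⟨B, fun n => hB ⟨n, rfl⟩⟩
  have hramp : Causal fun s : ℝ => max s 0 :=
    .of_continuousOn (by fun_prop) fun s hs => max_eq_right hs.le
  have hIoi : IntegrableOn q (Ioi 0) := by
    refine integrableOn_Ioi_of_intervalIntegral_norm_bounded (2 * (C + 1)) 0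
      (b := fun n : ℕ => (n : ℝ)) (l := atTop)
      (fun n => hqc.integrableOn_Icc.mono_set Ioc_subset_Icc_self)
      tendsto_natCast_atTop_atTop ?_
    filter_upwards [eventually_gt_atTop 0] with n hn
    have hn0 : (0 : ℝ) < n := by exact_mod_cast hn
    have h1 := integral_abs_le_norm_rampFunctional hq hqc (t := ((2 * n : ℕ) : ℝ))
      (by positivity)
    -- After `s ↦ 2n - s`, the weight `(2n - s)⁺` is at least `n` on `[0, n]`.
    have h2 : (n : ℝ) * ∫ s in (0 : ℝ)..n, ‖q s‖
        ≤ ∫ s, |max s 0 * q (((2 * n : ℕ) : ℝ) - s)| := by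
      rw [← integral_sub_left_eq_self _ volume (((2 * n : ℕ) : ℝ)),
        intervalIntegral.integral_of_le hn0.le, ← integral_const_mul,
        ← integral_indicator measurableSet_Ioc]
      have hint := (hq.integrable_conv hramp ((2 * n : ℕ) : ℝ)).abs
      refine integral_mono_of_nonneg (Eventually.of_forall fun s =>
        indicator_nonneg (fun _ _ => by positivity) s)
        (hint.congr (Eventually.of_forall fun s => by simp [mul_comm]))
        (Eventually.of_forall fun s => ?_)
      by_cases hs : s ∈ Ioc 0 (n : ℝ)
      swap
      · rw [indicator_of_notMem hs]
        exact abs_nonneg _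
      rw [indicator_of_mem hs]
      dsimp only
      rw [sub_sub_cancel, abs_mul, Real.norm_eq_abs]
      refine mul_le_mul_of_nonneg_right ?_ (abs_nonneg _)
      refine le_trans ?_ ((le_max_left _ _).trans (le_abs_self _))
      push_cast
      linarith [hs.2]
    have h3 := hC (2 * n)
    have h4 : (n : ℝ) * ∫ s in (0 : ℝ)..n, ‖q s‖ ≤ n * (2 * (C + 1)) := by
      refine (h2.trans h1).trans ?_
      push_cast at h3 ⊢
      nlinarith
    exact le_of_mul_le_mul_left h4 hn0
  rw [← integrableOn_univ, ← Iio_union_Ici (a := (0 : ℝ)), integrableOn_union,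
    integrableOn_Ici_iff_integrableOn_Ioi]
  exact ⟨integrableOn_zero.congr_fun (fun t ht => (hq.of_neg t ht).symm) measurableSet_Iio, hIoi⟩

end UniformBound

/-! ### Characteristic roots -/

section Roots

variable {τ : ℝ} {μ : SignedMeasure (Icc (-τ) (0 : ℝ))}

lemma Continuous.integrable_of_isFiniteMeasure {X E : Type*} [TopologicalSpace X] [CompactSpace X]
    [MeasurableSpace X] [OpensMeasurableSpace X] [NormedAddCommGroup E]
    [SecondCountableTopologyEither X E] {f : X → E} (hf : Continuous f) (ν : Measure X)
    [IsFiniteMeasure ν] : Integrable f ν :=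
  hf.integrable_of_hasCompactSupport (HasCompactSupport.of_compactSpace f)

lemma SignedMeasure.integral_eq_sub_of_continuous {E : Type*} [NormedAddCommGroup E]
    [NormedSpace ℝ E] {f : Icc (-τ) (0 : ℝ) → E} (hf : Continuous f) :
    ∫ᵛ u, f u ∂<•μ = ∫ u, f u ∂μ.toJordanDecomposition.posPart
      - ∫ u, f u ∂μ.toJordanDecomposition.negPart :=
  SignedMeasure.integral_eq_sub μ (hf.integrable_of_isFiniteMeasure _)
    (hf.integrable_of_isFiniteMeasure _)

lemma SignedMeasure.integral_clm_comp (L : ℂ →L[ℝ] ℝ) {f : Icc (-τ) (0 : ℝ) → ℂ}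
    (hf : Continuous f) : ∫ᵛ u, L (f u) ∂<•μ = L (∫ᵛ u, f u ∂<•μ) := by
  rw [integral_eq_sub_of_continuous (f := fun u => L (f u)) (by fun_prop),
    integral_eq_sub_of_continuous hf, map_sub,
    L.integral_comp_comm (hf.integrable_of_isFiniteMeasure _),
    L.integral_comp_comm (hf.integrable_of_isFiniteMeasure _)]

lemma SignedMeasure.integral_const_mul_of_continuous (k : ℂ) {f : Icc (-τ) (0 : ℝ) → ℂ}
    (hf : Continuous f) : ∫ᵛ u, k * f u ∂<•μ = k * ∫ᵛ u, f u ∂<•μ := by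
  rw [integral_eq_sub_of_continuous (by fun_prop), integral_eq_sub_of_continuous hf,
    integral_const_mul, integral_const_mul, mul_sub]

lemma SignedMeasure.integral_add_of_continuous {f g : Icc (-τ) (0 : ℝ) → ℂ}
    (hf : Continuous f) (hg : Continuous g) :
    ∫ᵛ u, (f u + g u) ∂<•μ = ∫ᵛ u, f u ∂<•μ + ∫ᵛ u, g u ∂<•μ := by
  rw [integral_eq_sub_of_continuous (by fun_prop), integral_eq_sub_of_continuous hf,
    integral_eq_sub_of_continuous hg,
    integral_add (hf.integrable_of_isFiniteMeasure _) (hg.integrable_of_isFiniteMeasure _),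
    integral_add (hf.integrable_of_isFiniteMeasure _) (hg.integrable_of_isFiniteMeasure _)]
  ring

/-- The Cesàro mean of a complex-valued function over `[0, T]`. -/
noncomputable def cesaroMean (w : ℝ → ℂ) (T : ℝ) : ℂ := (1 / T : ℝ) • ∫ t in (0 : ℝ)..T, w t

lemma isCesaro_clm_comp (L : ℂ →L[ℝ] ℝ) {w : ℝ → ℂ} (hw : Continuous w) {M : ℂ}
    (h : Tendsto (cesaroMean w) atTop (𝓝 M)) : IsCesaro fun t => L (w t) := by
  refine ⟨(L.continuous.comp hw).locallyIntegrable.locallyIntegrableOn _, L M,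
    ((L.continuous.tendsto M).comp h).congr fun T => ?_⟩
  rw [Function.comp_apply, cesaroMean, map_smul,
    L.intervalIntegral_comp_comm (hw.intervalIntegrable 0 T), smul_eq_mul]

lemma continuous_window {f : ℝ → ℂ} (hf : Continuous f) (θ : ℝ) :
    Continuous fun t => ∫ s in t..(t + θ), f s := by
  have hP : Continuous fun t => ∫ s in (0 : ℝ)..t, f s :=
    intervalIntegral.continuous_primitive (fun s t => hf.intervalIntegrable s t) 0
  have : (fun t => ∫ s in t..(t + θ), f s)
      = fun t => (∫ s in (0 : ℝ)..(t + θ), f s) - ∫ s in (0 : ℝ)..t, f s := by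
    ext t
    rw [intervalIntegral.integral_interval_sub_left (hf.intervalIntegrable _ _)
      (hf.intervalIntegrable _ _)]
  rw [this]
  exact (hP.comp (by fun_prop)).sub hP

/-- The hypothesis applies to complex solutions, through their real and imaginary parts. -/
lemma PreservesCesaro.exists_tendsto_cesaroMean (h : PreservesCesaro τ μ) {w f : ℝ → ℂ}
    (hw : ContDiff ℝ 1 w) (hf : Continuous f)
    (hd : ∀ t, HasDerivAt w ((∫ᵛ u, w (t + (u : ℝ)) ∂<•μ) + f t) t)
    (hadm : ∀ θ ∈ Ioc (0 : ℝ) 1, ∃ M : ℂ,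
      Tendsto (cesaroMean fun t => ∫ s in t..(t + θ), f s) atTop (𝓝 M)) :
    ∃ M : ℂ, Tendsto (cesaroMean w) atTop (𝓝 M) := by
  have key : ∀ L : ℂ →L[ℝ] ℝ, IsCesaro fun t => L (w t) := fun L => by
    refine h ⟨fun s => L (w s), by have := hw.continuous; fun_prop⟩ (fun t => L (f t))
      ((L.continuous.comp hf).locallyIntegrable.locallyIntegrableOn _) (fun θ hθ => ?_) _
      ⟨fun T _ => ?_, fun s => rfl, Eventually.of_forall fun t => ?_⟩
    · obtain ⟨M, hM⟩ := hadm θ hθ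
      simpa only [L.intervalIntegral_comp_comm (hf.intervalIntegrable _ _)] using
        isCesaro_clm_comp L (continuous_window hf θ) hM
    · exact (L.contDiff.comp hw).contDiffOn.absolutelyContinuousOnInterval
    · have hwt : Continuous fun u : Icc (-τ) (0 : ℝ) => w (t + (u : ℝ)) :=
        hw.continuous.comp (by fun_prop)
      rw [SignedMeasure.integral_clm_comp L hwt, ← map_add]
      exact L.hasFDerivAt.comp_hasDerivAt t (hd t)
  obtain ⟨-, A, hA⟩ := key Complex.reCLM
  obtain ⟨-, B, hB⟩ := key Complex.imCLM
  refine ⟨A + B * Complex.I, ((Complex.continuous_ofReal.tendsto A).comp hA |>.add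
    (((Complex.continuous_ofReal.tendsto B).comp hB).mul_const Complex.I)).congr fun T => ?_⟩
  have hi := hw.continuous.intervalIntegrable (μ := volume) 0 T
  rw [Function.comp_apply, Function.comp_apply, Complex.reCLM.intervalIntegral_comp_comm hi,
    Complex.imCLM.intervalIntegral_comp_comm hi, cesaroMean, Complex.real_smul,
    Complex.ofReal_mul, Complex.ofReal_mul, Complex.reCLM_apply, Complex.imCLM_apply]
  conv_rhs => rw [← Complex.re_add_im (∫ t in (0 : ℝ)..T, w t)]
  ring

lemma integral_delay_exp (z : ℂ) (t : ℝ) :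
    ∫ᵛ u : Icc (-τ) (0 : ℝ), Complex.exp (z * ((t + (u : ℝ) : ℝ) : ℂ)) ∂<•μ
      = Complex.exp (z * t) * (z - delayChar τ μ z) := by
  rw [delayChar, sub_sub_cancel,
    ← SignedMeasure.integral_const_mul_of_continuous _ (by fun_prop)]
  congr 1
  ext u
  rw [← Complex.exp_add]
  push_cast
  ring_nf

lemma hasDerivAt_cexp_mul_ofReal (z : ℂ) (t : ℝ) :
    HasDerivAt (fun t : ℝ => Complex.exp (z * t)) (Complex.exp (z * t) * z) t := by
  simpa using ((Complex.ofRealCLM.hasDerivAt (x := t)).const_mul z).cexp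

lemma contDiff_cexp_mul_ofReal (z : ℂ) : ContDiff ℝ 1 fun t : ℝ => Complex.exp (z * t) :=
  (contDiff_const.mul Complex.ofRealCLM.contDiff).cexp

lemma integral_cexp_mul_ofReal {z : ℂ} (hz : z ≠ 0) (a b : ℝ) :
    ∫ t in a..b, Complex.exp (z * t) = (Complex.exp (z * b) - Complex.exp (z * a)) / z :=
  integral_exp_mul_complex hz

lemma integral_ofReal_mul_cexp {z : ℂ} (hz : z ≠ 0) (T : ℝ) :
    ∫ t in (0 : ℝ)..T, (t : ℂ) * Complex.exp (z * t)
      = T * Complex.exp (z * T) / z - (Complex.exp (z * T) - 1) / z ^ 2 := by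
  have hd : ∀ t : ℝ, HasDerivAt
      (fun t : ℝ => (t : ℂ) * Complex.exp (z * t) / z - Complex.exp (z * t) / z ^ 2)
      ((t : ℂ) * Complex.exp (z * t)) t := fun t => by
    have h1 := hasDerivAt_cexp_mul_ofReal z t
    have h2 : HasDerivAt (fun t : ℝ => (t : ℂ)) 1 t := Complex.ofRealCLM.hasDerivAt
    refine (((h2.mul h1).div_const z).sub (h1.div_const (z ^ 2))).congr_deriv ?_
    field_simp
    ring
  rw [intervalIntegral.integral_eq_sub_of_hasDerivAt (fun t _ => hd t)
    (Continuous.intervalIntegrable (by fun_prop) _ _)]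
  simp
  ring

lemma norm_cexp_mul_ofReal (z : ℂ) (t : ℝ) : ‖Complex.exp (z * t)‖ = Real.exp (z.re * t) := by
  simp [Complex.norm_exp]

/-- A function whose norm is bounded is negligible after division by `T`. -/
lemma tendsto_inv_smul_of_bounded {G : ℝ → ℂ} {C : ℝ} (hG : ∀ T, ‖G T‖ ≤ C) :
    Tendsto (fun T : ℝ => (1 / T : ℝ) • G T) atTop (𝓝 0) := by
  have h0 : Tendsto (fun T : ℝ => (1 / T : ℝ)) atTop (𝓝 0) := by
    simpa using tendsto_inv_atTop_zero
  exact h0.zero_smul_isBoundedUnder_le (isBoundedUnder_of ⟨C, hG⟩)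

lemma norm_cexp_sub_one_le {z : ℂ} (hz : z.re = 0) (T : ℝ) : ‖Complex.exp (z * T) - 1‖ ≤ 2 := by
  refine (norm_sub_le _ _).trans ?_
  rw [norm_cexp_mul_ofReal, hz]
  norm_num

/-- Purely oscillating exponentials have Cesàro means. -/
lemma exists_tendsto_cesaroMean_cexp {z : ℂ} (hz : z.re = 0) (k : ℂ) :
    ∃ M : ℂ, Tendsto (cesaroMean fun t => k * Complex.exp (z * t)) atTop (𝓝 M) := by
  rcases eq_or_ne z 0 with rfl | hz0
  · refine ⟨k, tendsto_const_nhds.congr' ?_⟩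
    filter_upwards [eventually_gt_atTop 0] with T hT
    simp [cesaroMean, hT.ne']
  · refine ⟨0, ?_⟩
    have : cesaroMean (fun t => k * Complex.exp (z * t))
        = fun T : ℝ => (1 / T : ℝ) • (k * ((Complex.exp (z * T) - 1) / z)) := by
      ext T
      rw [cesaroMean, intervalIntegral.integral_const_mul, integral_cexp_mul_ofReal hz0]
      simp
    rw [this]
    refine tendsto_inv_smul_of_bounded (C := ‖k‖ * (2 / ‖z‖)) fun T => ?_
    rw [norm_mul, norm_div]
    gcongr
    exact norm_cexp_sub_one_le hz T

/-- A root with positive real part would make the exponentially growing solution `e^{zt}` of the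
unperturbed equation have a Cesàro limit. -/
lemma PreservesCesaro.re_nonpos (h : PreservesCesaro τ μ) {z : ℂ} (hz : delayChar τ μ z = 0) :
    z.re ≤ 0 := by
  by_contra! hre
  have hz0 : z ≠ 0 := by
    rintro rfl
    simp at hre
  obtain ⟨M, hM⟩ := h.exists_tendsto_cesaroMean (w := fun t => Complex.exp (z * t))
    (f := fun _ => 0) (contDiff_cexp_mul_ofReal z) continuous_const (fun t => by
      rw [integral_delay_exp, hz, sub_zero, add_zero]
      exact hasDerivAt_cexp_mul_ofReal z t)
    fun θ _ => ⟨0, tendsto_const_nhds.congr fun T => by simp [cesaroMean]⟩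
  have hev : ∀ᶠ T in atTop, ‖cesaroMean (fun t => Complex.exp (z * t)) T‖ ≤ ‖M‖ + 1 :=
    hM.norm.eventually_le_const (lt_add_one _)
  have hgrow : Tendsto (fun T : ℝ => z.re + z.re ^ 2 / 2 * T) atTop atTop :=
    tendsto_atTop_add_const_left _ _ (tendsto_id.const_mul_atTop (by positivity))
  obtain ⟨T, hT1, hT2, hT3⟩ := (hev.and ((hgrow.eventually_gt_atTop (‖z‖ * (‖M‖ + 1))).and
    (eventually_gt_atTop 0))).exists
  have hzn : 0 < ‖z‖ := norm_pos_iff.2 hz0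
  rw [cesaroMean, integral_cexp_mul_ofReal hz0, norm_smul, Real.norm_eq_abs,
    abs_of_pos (one_div_pos.2 hT3), norm_div, one_div, inv_mul_le_iff₀ hT3, div_le_iff₀ hzn] at hT1
  have h1 : Real.exp (z.re * T) - 1 ≤ ‖Complex.exp (z * T) - Complex.exp (z * (0 : ℝ))‖ := by
    refine le_trans ?_ (norm_sub_norm_le _ _)
    rw [norm_cexp_mul_ofReal]
    simp
  have h2 := Real.quadratic_le_exp_of_nonneg (x := z.re * T) (by positivity)
  nlinarith

/-- A root on the imaginary axis is excluded by resonance: `t e^{zt}` solves the equation perturbed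
by a constant multiple of `e^{zt}`. -/
lemma PreservesCesaro.re_ne_zero (h : PreservesCesaro τ μ) {z : ℂ} (hz : delayChar τ μ z = 0) :
    z.re ≠ 0 := by
  intro hre
  set D : ℂ := ∫ᵛ u : Icc (-τ) (0 : ℝ), ((u : ℝ) : ℂ) * Complex.exp (z * ((u : ℝ) : ℂ)) ∂<•μ with hD
  obtain ⟨M, hM⟩ := h.exists_tendsto_cesaroMean (w := fun t => (t : ℂ) * Complex.exp (z * t))
    (f := fun t => (1 - D) * Complex.exp (z * t))
    (Complex.ofRealCLM.contDiff.mul (contDiff_cexp_mul_ofReal z)) (by fun_prop) (fun t => by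
      have h2 : HasDerivAt (fun t : ℝ => (t : ℂ)) 1 t := Complex.ofRealCLM.hasDerivAt
      refine (h2.mul (hasDerivAt_cexp_mul_ofReal z t)).congr_deriv ?_
      have hsplit : (fun u : Icc (-τ) (0 : ℝ) =>
          ((t + (u : ℝ) : ℝ) : ℂ) * Complex.exp (z * ((t + (u : ℝ) : ℝ) : ℂ)))
          = fun u : Icc (-τ) (0 : ℝ) => (t : ℂ) * Complex.exp (z * ((t + (u : ℝ) : ℝ) : ℂ))
            + Complex.exp (z * t) * (((u : ℝ) : ℂ) * Complex.exp (z * ((u : ℝ) : ℂ))) := by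
        ext u
        push_cast
        rw [mul_add, Complex.exp_add]
        ring
      rw [hsplit, SignedMeasure.integral_add_of_continuous (by fun_prop) (by fun_prop),
        SignedMeasure.integral_const_mul_of_continuous _ (by fun_prop), integral_delay_exp, hz,
        SignedMeasure.integral_const_mul_of_continuous _ (by fun_prop), ← hD]
      ring)
    fun θ _ => by
      have : (fun t : ℝ => ∫ s in t..(t + θ), (1 - D) * Complex.exp (z * s))
          = fun t : ℝ => ((1 - D) * ∫ s in (0 : ℝ)..θ, Complex.exp (z * s))
            * Complex.exp (z * t) := by
        ext t
        have hs : ∀ s : ℝ, Complex.exp (z * ((s + t : ℝ) : ℂ))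
            = Complex.exp (z * s) * Complex.exp (z * t) := fun s => by
          rw [← Complex.exp_add]
          push_cast
          ring_nf
        rw [intervalIntegral.integral_const_mul, mul_assoc,
          ← intervalIntegral.integral_mul_const]
        simp only [← hs]
        rw [intervalIntegral.integral_comp_add_right fun s : ℝ => Complex.exp (z * s), zero_add,
          add_comm θ]
      rw [this]
      exact exists_tendsto_cesaroMean_cexp hre _
  rcases eq_or_ne z 0 with rfl | hz0
  · have h1 : Tendsto (fun T : ℝ => T / 2) atTop (𝓝 M.re) := by
      refine ((Complex.continuous_re.tendsto M).comp hM).congr' ?_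
      filter_upwards [eventually_gt_atTop 0] with T hT
      have : ∫ t in (0 : ℝ)..T, (t : ℂ) = ((T ^ 2 / 2 : ℝ) : ℂ) := by
        rw [intervalIntegral.integral_ofReal, integral_id]
        simp
      simp only [Function.comp_apply, cesaroMean, zero_mul, Complex.exp_zero, mul_one, this]
      rw [Complex.real_smul, ← Complex.ofReal_mul, Complex.ofReal_re]
      field_simp
    exact not_tendsto_nhds_of_tendsto_atTop (tendsto_id.atTop_div_const two_pos) _ h1
  · have hE : Tendsto (fun T : ℝ => Complex.exp (z * T)) atTop (𝓝 (M * z)) := by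
      have h0 := tendsto_inv_smul_of_bounded (G := fun T : ℝ => (Complex.exp (z * T) - 1) / z ^ 2)
        (C := 2 / ‖z‖ ^ 2) fun T => by
          rw [norm_div, norm_pow]
          gcongr
          exact norm_cexp_sub_one_le hre T
      have := (hM.add h0).mul_const z
      rw [add_zero] at this
      refine this.congr' ?_
      filter_upwards [eventually_gt_atTop 0] with T hT
      have hT' : (T : ℂ) ≠ 0 := by exact_mod_cast hT.ne'
      rw [cesaroMean, integral_ofReal_mul_cexp hz0]
      simp only [Complex.real_smul]
      push_cast
      field_simp
      ring
    -- Shifting the time by the half-period `π / Im z` reverses the sign of `e^{zt}`.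
    have him : z.im ≠ 0 := fun him => hz0 (Complex.ext hre him)
    have hshift : Tendsto (fun T : ℝ => -Complex.exp (z * T)) atTop (𝓝 (M * z)) := by
      refine (hE.comp (tendsto_atTop_add_const_right _ (Real.pi / z.im) tendsto_id)).congr
        fun T => ?_
      have hzp : z * ((Real.pi / z.im : ℝ) : ℂ) = Real.pi * Complex.I := by
        have hzI : z = z.im * Complex.I := by
          conv_lhs => rw [← Complex.re_add_im z, hre]
          simp
        have : (z.im : ℂ) ≠ 0 := by exact_mod_cast him
        rw [Complex.ofReal_div]
        nth_rewrite 1 [hzI]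
        field_simp
      simp only [Function.comp_apply, id, Complex.ofReal_add, mul_add, hzp, Complex.exp_add,
        Complex.exp_pi_mul_I]
      ring
    have hMz : M * z = -(M * z) := tendsto_nhds_unique hshift hE.neg
    have hnorm : ‖M * z‖ = 1 := by
      refine tendsto_nhds_unique hE.norm (tendsto_const_nhds.congr fun T => ?_)
      rw [norm_cexp_mul_ofReal, hre, zero_mul, Real.exp_zero]
    rw [self_eq_neg.1 hMz, norm_zero] at hnorm
    exact zero_ne_one hnorm

end Roots

theorem mainTheorem3 (τ : ℝ) (hτ : 0 < τ) (μ : SignedMeasure (Icc (-τ) (0 : ℝ)))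
    (h : ∀ (ψ : C(Icc (-τ) (0 : ℝ), ℝ)) (f : ℝ → ℝ),
      LocallyIntegrableOn f (Ici 0) →
      (∀ θ ∈ Ioc (0 : ℝ) 1, IsCesaro (fun t => ∫ s in t..(t + θ), f s)) →
      ∀ x : ℝ → ℝ, IsDelaySolution τ μ ψ f x → IsCesaro x) :
    (∀ r : ℝ → ℝ, IsDelayResolvent τ μ r → IntegrableOn r (Ici 0)) ∧
      ∀ z : ℂ, delayChar τ μ z = 0 → z.re < 0 := by
  have h' : PreservesCesaro τ μ := h
  refine ⟨fun r hr => ?_, fun z hz => lt_of_le_of_ne (h'.re_nonpos hz) (h'.re_ne_zero hz)⟩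
  exact (hr.integrable_of_smoothed (integrable_of_forall_tendsto
    (causal_expKernel.conv hr.causal) hr.continuous_smoothed (hr.exists_tendsto h'))).integrableOn
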